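/- **Setting.** Uncertain parameters $\xi\in\mathbb R^N$ are observed over stages $1,\dots,T$ and follow a probability distribution $\mathbb P$ with $\mathbb P(\bigcup_g\Psi_g)=1$, where $\Psi_1,\dots,\Psi_G\subset\mathbb R^N$ are nonempty and compact. Let $c(\cdot)$ and $b_g(\cdot)$ be affine in $\xi$ and let $A_g$ be a matrix with $K_g$ rows $A_{gk}$; $b_{gk}$ denotes the $k$-th component of $b_g$. Every decision (component of $x$) belongs to a stage in $\{0,\dots,T\}$. A matrix $E\in\mathbb R^{I\times N}$ maps $\xi$ to embedded parameters $\theta=E\xi$; each $\theta_i$ belongs to a stage in $\{1,\dots,T\}$ and depends only on the $\xi_n$ observed up to that stage, and for each $t$ the map from the $\xi_n$ observed up to stage $t$ to the $\theta_i$ of stages up to $t$ is injective. Put $E^+=(E^\top E)^{-1}E^\top$, $\Theta_g=E\Psi_g$, $\Theta=\bigcup_g\Theta_g$. For each $i$ let $\underline\theta_i=\min_{\theta\in\Theta}\theta_i=z_{i0}<z_{i1}<\dots<z_{iJ_i}=\max_{\theta\in\Theta}\theta_i$ be given (if $\theta_i$ is constant on $\Theta$, then $J_i=0$). Define * the folding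 $F_{ij}(\theta)=\min\{\max\{\theta_i-z_{i,j-1},0\},\,z_{ij}-z_{i,j-1}\}$ for $1\le i\le I$, $1\le j\le J_i$, and $F_i^+(\xi')=\underline\theta_i+\sum_j\xi'_{ij}$; * the lifting $L=F\circ E$, the retraction $R=E^+\circ F^+$, and the lifted distribution $\mathbb P'=\mathbb P\circ L^{-1}$; * the outer approximations $\widehat\Psi'_g=\{\xi': F^+(\xi')\in\Theta_g\}\cap\mathrm{conv}\,F(B_g)$, where $B_g$ is the smallest hyperrectangle containing $\Theta_g$; * for $z^-\le z^+$ in the grid $Z=\prod_i\{z_{i0},\dots,z_{iJ_i}\}$: $\;d'(\xi',[z^-,z^+])=\sum_i\bigl(\sum_{j:\,z_{ij}>z_i^+}\xi'_{ij}+z_i^--\underline\theta_i-\sum_{j:\,z_{ij}\le z_i^-}\xi'_{ij}\bigr)$ and $\bar d_g([z^-,z^+])=\max_{\theta\in\Theta_g}\min_{\theta'\in[z^-,z^+]}\|\theta-\theta'\|_1$; * the tightened outer approximations $\overline\Psi'_g=\{\xi'\in\widehat\Psi'_g:\ d'(\xi',[z^-,z^+])\le\bar d_g([z^-,z^+])\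 \ \forall z^-\le z^+\text{ in }Z\}$. For a family $U=(U_g)_g$ of sets of lifted parameters, $\mathrm{Aff}\,\mathcal P'(\mathbb P',U)$ is the problem of minimizing $\mathbb E_{\mathbb P'}[c(R(\xi'))^\top x'(\xi')]$ over all affine, non-anticipative $x'(\cdot)$ with $A_gx'(\xi')\le b_g(R(\xi'))$ for all $g$ and $\xi'\in U_g$. Non-anticipative means that $x'_n$ depends only on those $\xi'_{ij}$ for which the stage of $\theta_i$ is at most the stage of decision $n$; we then call $(n,(i,j))$ an admissible pair. A Slater point is an affine, non-anticipative $x'(\cdot)$ that satisfies all these inequality constraints strictly. A set is conic representable if it has the form $\{x: Vx\succeq_{\mathcal K}d\}$ with a proper cone $\mathcal K$ (closed, convex, pointed, with nonempty interior). **Statement.** Assume that every $\Psi_g$ is conic representable, and consider the program $$ \begin{aligned} \max_{\zeta,s}\quad & -\sum_{g,k}\bigl[b_{gk}(R(\zeta_{gk}))+(s_{gk}-1)\,b_{gk}(R(0))\bigr]\\ \text{s.t.}\quad & \Bigl(\sum_{g,k}A_{gk}^\top\zeta_{gk}^\top\Bigr)_{n,(i,j)}=-\Bigl(\mathbb E_{\mathbb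 P'}[c(R(\xi'))\,\xi'^\top]\Bigr)_{n,(i,j)}\quad\text{for all admissible }(n,(i,j)),\\ & \sum_{g,k}s_{gk}A_{gk}^\top=-\mathbb E_{\mathbb P'}[c(R(\xi'))],\\ & \zeta_{gk}\in s_{gk}\widehat\Psi'_g,\quad s_{gk}\ge0\quad\forall g,k. \end{aligned}\tag{D} $$ (If every decision may depend on all lifted parameters, the first constraint is the full matrix equation.) (i) (D) is a convex conic program (its objective is affine and its feasible set is conic representable), and if $\mathrm{Aff}\,\mathcal P'(\mathbb P',\widehat\Psi')$ has a Slater point, then its optimal value equals that of (D). (ii) The program obtained from (D) by adding the affine cuts $$s_{gk}\,d'\bigl(\zeta_{gk}/s_{gk},[z^-,z^+]\bigr)\le s_{gk}\,\bar d_g([z^-,z^+])\qquad\forall g,k,\ \forall z^-\le z^+\text{ in }Z$$ (which read $0\le0$ where $s_{gk}=0$) is again a convex conic program, and if $\mathrm{Aff}\,\mathcal P'(\mathbb P',\overline\Psi')$ has a Slater point, then its optimal value equals that of this tightened program. Optimal values are taken in $[-\infty,\infty]$. -/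

import Mathlib

open MeasureTheory

noncomputable section

/-- A set `S` in a real vector space is conic representable if `S = {x : V x ⪰_K d}` for a linear
map `V` into some `ℝ^m`, a vector `d` and a proper cone `K ⊆ ℝ^m`. Here a proper cone is a closed
convex cone that is pointed (contains no line, called `Salient` in Mathlib) and has nonempty
interior. -/
def IsConicRepresentable {E : Type*} [AddCommGroup E] [Module ℝ E] (S : Set E) : Prop :=
  ∃ (m : ℕ) (V : E →ₗ[ℝ] (Fin m → ℝ)) (d : Fin m → ℝ) (K : ConvexCone ℝ (Fin m → ℝ)),
    IsClosed (K : Set (Fin m → ℝ)) ∧ K.Salient ∧ (interior (K : Set (Fin m → ℝ))).Nonempty ∧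
      S = {x | V x - d ∈ K}

/-- The optimization of an objective `obj` over a set `feas` is a convex conic program: the
objective is affine and the feasible set is conic representable. -/
def IsConicProgram {E : Type*} [AddCommGroup E] [Module ℝ E] (feas : Set E) (obj : E → ℝ) : Prop :=
  IsConicRepresentable feas ∧ ∃ f : E →ᵃ[ℝ] ℝ, ∀ x, f x = obj x

/-- The data of a multi-stage problem together with an embedding and a grid of breakpoints.

Stages are recorded coordinatewise. The parameter (or embedded parameter) stages `1, …, T` are
numbered by `Fin T`, so that `paramStage n = t` means that coordinate `n` is observed at stage
`t + 1`; the decision stages `0, 1, …, T` are numbered by `Fin (T + 1)`, stage `0` comprising the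
here-and-now decisions. -/
structure MultistageProblem where
  /-- number of stages -/
  T : ℕ
  /-- number of uncertain parameters -/
  N : ℕ
  /-- number of embedded parameters -/
  I : ℕ
  /-- number of decisions -/
  D : ℕ
  /-- number of support subsets -/
  G : ℕ
  /-- number of pieces into which the range of the `i`-th embedded parameter is divided -/
  J : Fin I → ℕ
  /-- number of constraints attached to the `g`-th support subset -/
  K : Fin G → ℕ
  paramStage : Fin N → Fin T
  embStage : Fin I → Fin T
  decStage : Fin D → Fin (T + 1)
  /-- objective coefficients -/
  c : (Fin N → ℝ) →ᵃ[ℝ] (Fin D → ℝ)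
  /-- constraint matrices -/
  A : ∀ g, Matrix (Fin (K g)) (Fin D) ℝ
  /-- constraint right-hand sides -/
  b : ∀ g, (Fin N → ℝ) →ᵃ[ℝ] (Fin (K g) → ℝ)
  /-- support subsets -/
  Ψ : Fin G → Set (Fin N → ℝ)
  isCompact_Ψ : ∀ g, IsCompact (Ψ g)
  nonempty_Ψ : ∀ g, (Ψ g).Nonempty
  /-- distribution of the uncertain parameters -/
  P : Measure (Fin N → ℝ)
  isProbabilityMeasure_P : IsProbabilityMeasure P
  P_support : P (⋃ g, Ψ g) = 1
  /-- embedding matrix -/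
  E : Matrix (Fin I) (Fin N) ℝ
  /-- the stage-`t` embedded parameters depend only on the parameters observed up to stage `t` -/
  E_causal : ∀ i n, embStage i < paramStage n → E i n = 0
  /-- up to every stage, the embedding is an injective map of the parameters observed so far -/
  E_injective : ∀ (t : Fin T) (u v : Fin N → ℝ),
    (∀ i, embStage i ≤ t → E.mulVec u i = E.mulVec v i) → ∀ n, paramStage n ≤ t → u n = v n
  /-- `z i 0 < z i 1 < ⋯ < z i (J i)`: breakpoints, with the bounds of the embedded support -/
  z : ∀ i, Fin (J i + 1) → ℝ
  z_strictMono : ∀ i, StrictMono (z i)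
  z_zero : ∀ i, IsLeast ((fun u => E.mulVec u i) '' ⋃ g, Ψ g) (z i 0)
  z_last : ∀ i, IsGreatest ((fun u => E.mulVec u i) '' ⋃ g, Ψ g) (z i (Fin.last (J i)))

namespace MultistageProblem

variable (S : MultistageProblem)

/-- Index set of the coordinates of the lifted parameters. -/
abbrev LiftIdx : Type := Σ i : Fin S.I, Fin (S.J i)

/-- The embedded support subset. -/
def Θ (g : Fin S.G) : Set (Fin S.I → ℝ) := S.E.mulVec '' S.Ψ g

/-- The folding operator. -/
def fold (θ : Fin S.I → ℝ) : S.LiftIdx → ℝ := fun l =>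
  if θ l.1 < S.z l.1 l.2.castSucc then 0
  else if θ l.1 ≤ S.z l.1 l.2.succ then θ l.1 - S.z l.1 l.2.castSucc
  else S.z l.1 l.2.succ - S.z l.1 l.2.castSucc

/-- The left-inverse of the folding operator. -/
def unfold (ξ : S.LiftIdx → ℝ) : Fin S.I → ℝ := fun i => S.z i 0 + ∑ j, ξ ⟨i, j⟩

/-- The left Moore-Penrose inverse of the embedding matrix. -/
def Eplus : Matrix (Fin S.N) (Fin S.I) ℝ := (S.E.transpose * S.E)⁻¹ * S.E.transpose

/-- The lifting operator. -/
def lift (u : Fin S.N → ℝ) : S.LiftIdx → ℝ := S.fold (S.E.mulVec u)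

/-- The retraction operator. -/
def retr (ξ : S.LiftIdx → ℝ) : Fin S.N → ℝ := S.Eplus.mulVec (S.unfold ξ)

/-- The lifted probability distribution. -/
def P' : Measure (S.LiftIdx → ℝ) := (S.P.restrict (⋃ g, S.Ψ g)).map S.lift

/-- The smallest hyperrectangle containing the embedded support subset. -/
def box (g : Fin S.G) : Set (Fin S.I → ℝ) :=
  Set.Icc (fun i => sInf ((fun θ => θ i) '' S.Θ g)) (fun i => sSup ((fun θ => θ i) '' S.Θ g))

/-- The outer approximation of the lifted support subset. -/
def outer (g : Fin S.G) : Set (S.LiftIdx → ℝ) :=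
  {ξ | S.unfold ξ ∈ S.Θ g} ∩ convexHull ℝ (S.fold '' S.box g)

/-- The breakpoint grid. -/
def grid : Set (Fin S.I → ℝ) := {v | ∀ i, ∃ j, v i = S.z i j}

/-- The `l₁`-distance of a point to a hyperrectangle. -/
def dist₁ (θ zl zu : Fin S.I → ℝ) : ℝ :=
  sInf ((fun θ' => ∑ i, |θ i - θ' i|) '' Set.Icc zl zu)

/-- The maximal `l₁`-distance of a point of the embedded support subset to a hyperrectangle. -/
def dbar (g : Fin S.G) (zl zu : Fin S.I → ℝ) : ℝ :=
  sSup ((fun θ => S.dist₁ θ zl zu) '' S.Θ g)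

/-- The extension of the grid distance to lifted parameters. -/
def d' (ξ : S.LiftIdx → ℝ) (zl zu : Fin S.I → ℝ) : ℝ :=
  ∑ i, ((∑ j with zu i < S.z i (Fin.succ j), ξ ⟨i, j⟩) + zl i - S.z i 0
    - ∑ j with S.z i (Fin.succ j) ≤ zl i, ξ ⟨i, j⟩)

/-- The refined outer approximation of the lifted support subset. -/
def refined (g : Fin S.G) : Set (S.LiftIdx → ℝ) :=
  {ξ ∈ S.outer g | ∀ zl ∈ S.grid, ∀ zu ∈ S.grid, zl ≤ zu → S.d' ξ zl zu ≤ S.dbar g zl zu}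

/-- Decision `d` may depend on the embedded parameter `i`, that is, the latter is observed no later
than the stage of `d`. (The 0-based `embStage i` stands for stage `embStage i + 1`.) -/
def Observes (d : Fin S.D) (i : Fin S.I) : Prop := (S.embStage i : ℕ) < (S.decStage d : ℕ)

/-- The affine decision rules on the lifted space. -/
abbrev Policy : Type := (S.LiftIdx → ℝ) →ᵃ[ℝ] (Fin S.D → ℝ)

/-- Non-anticipativity in the lifted space: a decision depends only on the lifted parameters that
stem from embedded parameters observed up to its stage. -/
def NonAnticipative (x : S.Policy) : Prop :=
  ∀ (d : Fin S.D) (ξ ξ' : S.LiftIdx → ℝ),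
    (∀ l : S.LiftIdx, S.Observes d l.1 → ξ l = ξ' l) → x ξ d = x ξ' d

/-- Feasible affine decision rules of the lifted problem over the family `U` of supports. -/
def affFeasible (U : Fin S.G → Set (S.LiftIdx → ℝ)) : Set S.Policy :=
  {x | S.NonAnticipative x ∧
    ∀ g, ∀ ξ ∈ U g, ∀ k, (S.A g).mulVec (x ξ) k ≤ S.b g (S.retr ξ) k}

/-- `x` is a Slater point of the affine lifted problem: all constraints hold strictly. -/
def IsSlaterPoint (U : Fin S.G → Set (S.LiftIdx → ℝ)) (x : S.Policy) : Prop :=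
  S.NonAnticipative x ∧
    ∀ g, ∀ ξ ∈ U g, ∀ k, (S.A g).mulVec (x ξ) k < S.b g (S.retr ξ) k

/-- Expected cost of an affine decision rule. -/
def cost (x : S.Policy) : ℝ := ∫ ξ, S.c (S.retr ξ) ⬝ᵥ x ξ ∂S.P'

/-- Optimal value of the affine decision rule approximation of the lifted problem. -/
def affValue (U : Fin S.G → Set (S.LiftIdx → ℝ)) : EReal :=
  ⨅ x ∈ S.affFeasible U, (S.cost x : EReal)

/-- The variables `(ζ, s)` of the conic program. -/
abbrev DualVar : Type :=
  (∀ g, Fin (S.K g) → S.LiftIdx → ℝ) × (∀ g, Fin (S.K g) → ℝ)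

/-- The objective function of the conic program. -/
def dualObj (v : S.DualVar) : ℝ :=
  -∑ g, ∑ k, (S.b g (S.retr (v.1 g k)) k + (v.2 g k - 1) * S.b g (S.retr 0) k)

/-- The feasible set of the conic program. The first equation is the matrix equation
`∑ A_gkᵀ ζ_gkᵀ = -𝔼[c(R(ξ')) ξ'ᵀ]` in the entries that belong to coefficients of non-anticipative
affine decision rules. -/
def dualFeasible : Set S.DualVar :=
  {v | (∀ (d : Fin S.D) (l : S.LiftIdx), S.Observes d l.1 →
          ∑ g, ∑ k, S.A g k d * v.1 g k l = -∫ ξ, S.c (S.retr ξ) d * ξ l ∂S.P') ∧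
       (∀ d : Fin S.D,
          ∑ g, ∑ k, v.2 g k * S.A g k d = -∫ ξ, S.c (S.retr ξ) d ∂S.P') ∧
       (∀ g k, 0 ≤ v.2 g k ∧ ∃ ξ ∈ S.outer g, v.1 g k = v.2 g k • ξ)}

/-- The feasible set of the conic program tightened by the affine cuts. -/
def dualFeasibleCuts : Set S.DualVar :=
  {v ∈ S.dualFeasible | ∀ g k, ∀ zl ∈ S.grid, ∀ zu ∈ S.grid, zl ≤ zu →
    v.2 g k * S.d' ((1 / v.2 g k) • v.1 g k) zl zu ≤ v.2 g k * S.dbar g zl zu}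

/-- Optimal value of the conic program over the feasible set `feas`. -/
def dualValue (feas : Set S.DualVar) : EReal :=
  ⨆ v ∈ feas, (S.dualObj v : EReal)

end MultistageProblem

end

/-! Non-anticipative affine rules are coefficient vectors `y`, and the cost is linear in `y`
(`cost_policy`). Feasibility over supports `U g` says `y ⬝ᵥ T v ≤ o v` for all `v` in a product of
cones over the `U g`, where `T = coefMap` and `o = homObj`; indeed `o v - y ⬝ᵥ T v` is the sum of
the homogenized slacks (`homObj_sub_dotProduct`). The conic program is the dual of this system, so
weak duality is immediate.

For strong duality, a Slater point makes `o - y ⬝ᵥ T` positive on the cone away from its apex. Since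
the supports are compact, the cone is closed, and positivity on its unit sphere becomes coercivity.
This makes the relevant linear image of the cone closed, and separation yields a dual solution for
every real lower bound of the primal (`exists_conic_dual`).

Conic representability of the `Ψ g` enters only through their convexity. In return, every closed
convex set in finite dimension is conic representable (`Convex.isConicRepresentable_of_isClosed`),
so it is enough that the dual feasible sets are closed and convex. The cuts turn the cones over
`outer` into the cones over `refined`, hence both claims are instances of one duality statement. -/

noncomputable section

/-! ### Closed convex sets and conic representability -/

/-- A closed convex set in a finite-dimensional space is an intersection of half-spaces. -/
theorem mem_of_forall_halfspace {E : Type*} [NormedAddCommGroup E] [NormedSpace ℝ E]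
    {C : Set E} (hcl : IsClosed C) (hconv : Convex ℝ C) {x : E}
    (h : ∀ (a : E →L[ℝ] ℝ) (β : ℝ), (∀ y ∈ C, a y ≤ β) → a x ≤ β) : x ∈ C := by
  by_contra hx
  obtain ⟨a, u, hau, hux⟩ := geometric_hahn_banach_closed_point hconv hcl hx
  exact absurd (h a u fun y hy => (hau y hy).le) (not_le.2 hux)

/-- Homogenize all valid inequalities `a x ≤ β` to `β t - a x ≥ 0`, so that `C` is the slice `t =
1`. An extra coordinate with weight `‖a‖ + |β|`, set to zero on the slice, provides interior;
dividing by the common kernel `N` of the functionals makes the cone pointed. -/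
theorem Convex.isConicRepresentable_of_isClosed {E : Type*} [NormedAddCommGroup E]
    [NormedSpace ℝ E] [FiniteDimensional ℝ E] {C : Set E} (hconv : Convex ℝ C)
    (hcl : IsClosed C) : IsConicRepresentable C := by
  let F : Type _ := {i : (E →L[ℝ] ℝ) × ℝ // ∀ y ∈ C, i.1 y ≤ i.2}
  let ψ : F → (E × ℝ × ℝ) →ₗ[ℝ] ℝ := fun i =>
    i.1.2 • (LinearMap.fst ℝ ℝ ℝ ∘ₗ LinearMap.snd ℝ E (ℝ × ℝ))
      - i.1.1.toLinearMap ∘ₗ LinearMap.fst ℝ E (ℝ × ℝ)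
      + (‖i.1.1‖ + |i.1.2|) • (LinearMap.snd ℝ ℝ ℝ ∘ₗ LinearMap.snd ℝ E (ℝ × ℝ))
  have hψ : ∀ i w, ψ i w = i.1.2 * w.2.1 - i.1.1 w.1 + (‖i.1.1‖ + |i.1.2|) * w.2.2 := by
    intro i w; simp [ψ]
  let N : Submodule ℝ (E × ℝ × ℝ) := ⨅ i, LinearMap.ker (ψ i)
  have hN : ∀ w, w ∈ N ↔ ∀ i, ψ i w = 0 := by intro w; simp [N, Submodule.mem_iInf]
  let e := (Module.finBasis ℝ ((E × ℝ × ℝ) ⧸ N)).equivFun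
  let π := e.toLinearMap ∘ₗ N.mkQ
  have hπs : Function.Surjective π := e.surjective.comp N.mkQ_surjective
  have hπk : ∀ w, π w = 0 → w ∈ N := by
    intro w hw
    simpa [π] using hw
  obtain ⟨s, hs⟩ := π.exists_rightInverse_of_surjective (LinearMap.range_eq_top.2 hπs)
  have hs' : ∀ y, π (s y) = y := fun y => LinearMap.congr_fun hs y
  -- Each `ψ i` vanishes on `N`, so it descends to the quotient and the choice of the section `s` is
  -- immaterial.
  have hψs : ∀ i w, ψ i (s (π w)) = ψ i w := by
    intro i w
    have : s (π w) - w ∈ N := hπk _ (by rw [map_sub, hs', sub_self])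
    have := (hN _).1 this i
    rwa [map_sub, sub_eq_zero] at this
  let K : ConvexCone ℝ (Fin (Module.finrank ℝ ((E × ℝ × ℝ) ⧸ N)) → ℝ) :=
    { carrier := {y | ∀ i, 0 ≤ ψ i (s y)}
      smul_mem' := by
        intro c hc y hy i
        rw [map_smul, map_smul, smul_eq_mul]
        exact mul_nonneg hc.le (hy i)
      add_mem' := by
        intro y hy y' hy' i
        rw [map_add, map_add]
        exact add_nonneg (hy i) (hy' i) }
  have hK : ∀ y, y ∈ K ↔ ∀ i, 0 ≤ ψ i (s y) := fun y => Iff.rfl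
  refine ⟨_, π ∘ₗ LinearMap.inl ℝ E (ℝ × ℝ), - π (0, 1, 0), K, ?_, ?_, ?_, ?_⟩
  · have : (K : Set _) = ⋂ i, {y | 0 ≤ ψ i (s y)} := by
      ext y; simp [hK]
    rw [this]
    exact isClosed_iInter fun i => isClosed_le continuous_const
      (LinearMap.continuous_of_finiteDimensional (ψ i ∘ₗ s))
  · intro y hy hy0 hny
    apply hy0
    have : s y ∈ N := (hN _).2 fun i => le_antisymm (by
      have := hny i
      rw [map_neg, map_neg] at this
      linarith) (hy i)
    have h2 : π (s y) = 0 := by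
      simpa [π] using this
    rwa [hs'] at h2
  -- On this ball the first two terms of `ψ i` are at least `-(‖a‖ + |β|) / 2` in total and the last
  -- is at least `(‖a‖ + |β|) / 2`, uniformly in `i`.
  · refine ⟨π (0, 0, 1), mem_interior.2 ⟨π '' Metric.ball (0, 0, 1) (1 / 2), ?_,
      π.isOpenMap_of_finiteDimensional hπs _ Metric.isOpen_ball,
      Set.mem_image_of_mem _ (Metric.mem_ball_self (by norm_num))⟩⟩
    rintro _ ⟨w, hw, rfl⟩ i
    rw [hψs, hψ]
    rw [mem_ball_iff_norm] at hw
    have h1 : ‖w.1‖ ≤ 1 / 2 := by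
      have := (norm_fst_le (w - (0, 0, 1))).trans hw.le
      simpa using this
    have h2 : |w.2.1| ≤ 1 / 2 := by
      have := ((norm_fst_le (w - (0, 0, 1)).2).trans (norm_snd_le _)).trans hw.le
      simpa using this
    have h3 : |w.2.2 - 1| ≤ 1 / 2 := by
      have := ((norm_snd_le (w - (0, 0, 1)).2).trans (norm_snd_le _)).trans hw.le
      simpa using this
    have h4 : i.1.1 w.1 ≤ ‖i.1.1‖ * (1 / 2) :=
      ((le_abs_self _).trans (i.1.1.le_opNorm _)).trans
        (mul_le_mul_of_nonneg_left h1 (norm_nonneg _))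
    have h5 : -(|i.1.2| * (1 / 2)) ≤ i.1.2 * w.2.1 := by
      refine le_trans ?_ (neg_abs_le _)
      rw [abs_mul]
      exact neg_le_neg (mul_le_mul_of_nonneg_left h2 (abs_nonneg _))
    have h6 : (‖i.1.1‖ + |i.1.2|) * (1 / 2) ≤ (‖i.1.1‖ + |i.1.2|) * w.2.2 :=
      mul_le_mul_of_nonneg_left (by linarith [(abs_le.1 h3).1]) (by positivity)
    linarith
  · ext x
    have hx : (π ∘ₗ LinearMap.inl ℝ E (ℝ × ℝ)) x - -π (0, 1, 0) = π (x, 1, 0) := by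
      rw [sub_neg_eq_add, LinearMap.comp_apply, ← map_add]
      simp
    rw [Set.mem_ofPred_eq, hx, hK]
    simp only [hψs, hψ]
    constructor
    · intro hxC i
      have := i.2 x hxC
      simp only [mul_one, mul_zero, add_zero]
      linarith
    · intro h
      refine mem_of_forall_halfspace hcl hconv fun a β hab => ?_
      have := h ⟨(a, β), hab⟩
      simp only [mul_one, mul_zero, add_zero] at this
      linarith

theorem IsConicRepresentable.convex {E : Type*} [AddCommGroup E] [Module ℝ E] {C : Set E}
    (h : IsConicRepresentable C) : Convex ℝ C := by
  obtain ⟨m, V, d, K, -, -, -, rfl⟩ := h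
  have := K.convex.affine_preimage (V.toAffineMap - AffineMap.const ℝ E d)
  simpa [Set.preimage] using this

/-! ### Closed images of cones and strong conic duality -/

/-- The image of a closed cone under a linear map is closed if the map, composed with a suitable
linear functional, is coercive on the cone. -/
theorem isClosed_image_of_coercive {X Y : Type*} [NormedAddCommGroup X] [NormedSpace ℝ X]
    [FiniteDimensional ℝ X] [NormedAddCommGroup Y] [NormedSpace ℝ Y] {Q : Set X}
    (hcl : IsClosed Q) {T : X → Y} (hT : Continuous T) {φ : Y → ℝ} (hφ : Continuous φ) {ε : ℝ}
    (hε : 0 < ε) (h : ∀ q ∈ Q, ε * ‖q‖ ≤ φ (T q)) : IsClosed (T '' Q) := by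
  have : ProperSpace X := FiniteDimensional.proper ℝ X
  refine isClosed_of_closure_subset fun m hm => ?_
  have hZ : IsCompact (Q ∩ Metric.closedBall 0 ((φ m + 1) / ε)) :=
    (isCompact_closedBall _ _).inter_left hcl
  have hsub : {y | φ y < φ m + 1} ∩ T '' Q ⊆ T '' (Q ∩ Metric.closedBall 0 ((φ m + 1) / ε)) := by
    rintro _ ⟨hlt, q, hq, rfl⟩
    refine ⟨q, ⟨hq, ?_⟩, rfl⟩
    rw [mem_closedBall_zero_iff, le_div_iff₀ hε, mul_comm]
    exact (h q hq).trans (le_of_lt hlt)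
  have hopen : IsOpen {y | φ y < φ m + 1} := isOpen_lt hφ continuous_const
  have h1 : m ∈ closure ({y | φ y < φ m + 1} ∩ T '' Q) :=
    hopen.inter_closure ⟨show φ m < φ m + 1 by linarith, hm⟩
  have h2 := closure_minimal hsub (hZ.image hT).isClosed h1
  exact Set.image_mono Set.inter_subset_left h2

/-- A linear functional that is positive on a closed cone without its apex is coercive on it. -/
theorem exists_coercive_of_pos {X : Type*} [NormedAddCommGroup X] [NormedSpace ℝ X]
    [FiniteDimensional ℝ X] {Q : Set X} (hcl : IsClosed Q)
    (hsmul : ∀ t : ℝ, 0 < t → ∀ q ∈ Q, t • q ∈ Q) (φ : X →ₗ[ℝ] ℝ)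
    (hφ : ∀ q ∈ Q, q ≠ 0 → 0 < φ q) : ∃ ε > 0, ∀ q ∈ Q, ε * ‖q‖ ≤ φ q := by
  have : ProperSpace X := FiniteDimensional.proper ℝ X
  have hK : IsCompact (Q ∩ Metric.sphere 0 1) := (isCompact_sphere _ _).inter_left hcl
  obtain ⟨ε, hε, h⟩ : ∃ ε > 0, ∀ q ∈ Q ∩ Metric.sphere 0 1, ε ≤ φ q := by
    rcases (Q ∩ Metric.sphere 0 1).eq_empty_or_nonempty with he | hne
    · exact ⟨1, one_pos, by simp [he]⟩
    · obtain ⟨q, ⟨hq, hq1⟩, hmin⟩ :=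
        hK.exists_isMinOn hne (LinearMap.continuous_of_finiteDimensional φ).continuousOn
      exact ⟨φ q, hφ q hq (ne_zero_of_mem_unit_sphere ⟨q, hq1⟩), fun q' hq' => hmin hq'⟩
  refine ⟨ε, hε, fun q hq => ?_⟩
  rcases eq_or_ne q 0 with rfl | hq0
  · simp
  have hn : 0 < ‖q‖ := norm_pos_iff.2 hq0
  have := h (‖q‖⁻¹ • q) ⟨hsmul _ (inv_pos.2 hn) q hq, by simp [norm_smul, hn.ne']⟩
  rw [map_smul, smul_eq_mul, inv_mul_eq_div, le_div_iff₀ hn] at this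
  exact this

/-- Strong conic duality with dual attainment under a Slater condition. -/
theorem exists_conic_dual {X κ : Type*} [NormedAddCommGroup X] [NormedSpace ℝ X]
    [FiniteDimensional ℝ X] [Fintype κ] {Q : Set X} (hcl : IsClosed Q) (hconv : Convex ℝ Q)
    (h0 : (0 : X) ∈ Q) (hsmul : ∀ t : ℝ, 0 < t → ∀ q ∈ Q, t • q ∈ Q)
    (T : X →ₗ[ℝ] (κ → ℝ)) (o : X →ₗ[ℝ] ℝ) (f xs : κ → ℝ) {p : ℝ}
    (hslater : ∀ q ∈ Q, q ≠ 0 → xs ⬝ᵥ T q < o q)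
    (hp : ∀ y : κ → ℝ, (∀ q ∈ Q, y ⬝ᵥ T q ≤ o q) → p ≤ f ⬝ᵥ y) :
    ∃ q ∈ Q, T q = -f ∧ p ≤ -o q := by
  obtain ⟨ε, hε, hslater⟩ : ∃ ε > 0, ∀ q ∈ Q, ε * ‖q‖ ≤ o q - xs ⬝ᵥ T q := by
    let φ : X →ₗ[ℝ] ℝ := o - dotProductBilin ℝ ℝ xs ∘ₗ T
    exact exists_coercive_of_pos hcl hsmul φ fun q hq hq0 => sub_pos.2 (hslater q hq hq0)
  -- The extra coordinate `r ≥ 0` absorbs slack in the objective: `(-f, -p)` lies in the image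
  -- exactly when some `q ∈ Q` has `T q = -f` and `o q ≤ -p`.
  let Q' : Set (X × ℝ) := Q ×ˢ Set.Ici 0
  let T' : X × ℝ →ₗ[ℝ] (κ → ℝ) × ℝ :=
    (T ∘ₗ LinearMap.fst ℝ X ℝ).prod (o ∘ₗ LinearMap.fst ℝ X ℝ + LinearMap.snd ℝ X ℝ)
  have hT' : ∀ q, T' q = (T q.1, o q.1 + q.2) := fun q => rfl
  have hMconv : Convex ℝ (T' '' Q') := (hconv.prod (convex_Ici 0)).linear_image T'
  have hcont : Continuous fun m : (κ → ℝ) × ℝ => m.2 - xs ⬝ᵥ m.1 := by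
    simp only [dotProduct]
    fun_prop
  have hMcl : IsClosed (T' '' Q') := by
    refine isClosed_image_of_coercive (hcl.prod isClosed_Ici)
      (LinearMap.continuous_of_finiteDimensional T') hcont (ε := min ε 1)
      (lt_min hε one_pos) ?_
    rintro ⟨q, r⟩ ⟨hq, hr⟩
    have hr : 0 ≤ r := hr
    have h1 := hslater q hq
    rw [hT']
    have h2 : min ε 1 * ‖q‖ ≤ ε * ‖q‖ :=
      mul_le_mul_of_nonneg_right (min_le_left _ _) (norm_nonneg _)
    have h3 : min ε 1 * r ≤ 1 * r := mul_le_mul_of_nonneg_right (min_le_right _ _) hr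
    have h4 : ‖(q, r)‖ ≤ ‖q‖ + r := by
      rw [Prod.norm_mk, Real.norm_of_nonneg hr]
      exact max_le (by linarith) (by linarith [norm_nonneg q])
    have h5 : min ε 1 * ‖(q, r)‖ ≤ min ε 1 * (‖q‖ + r) :=
      mul_le_mul_of_nonneg_left h4 (le_min hε.le zero_le_one)
    change _ ≤ o q + r - xs ⬝ᵥ T q
    linarith
  by_cases hmem : ((-f, -p) : (κ → ℝ) × ℝ) ∈ T' '' Q'
  · obtain ⟨⟨q, r⟩, ⟨hq, hr⟩, he⟩ := hmem
    have hr : 0 ≤ r := hr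
    rw [hT', Prod.mk.injEq] at he
    have h2 : o q + r = -p := he.2
    exact ⟨q, hq, he.1, by linarith⟩
  exfalso
  obtain ⟨φ, u, hu, hφ⟩ := geometric_hahn_banach_point_closed hMconv hMcl hmem
  classical
  let y : κ → ℝ := fun i => φ (Pi.single i 1, 0)
  let μ : ℝ := φ (0, 1)
  have hφe : ∀ v r, φ (v, r) = y ⬝ᵥ v + μ * r := by
    intro v r
    have h1 : ((v, r) : (κ → ℝ) × ℝ) =
        (∑ i, v i • ((Pi.single i 1 : κ → ℝ), (0 : ℝ))) + r • ((0 : κ → ℝ), (1 : ℝ)) := by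
      ext i
      · simp [Prod.fst_sum, Finset.sum_apply, Pi.single_apply]
      · simp [Prod.snd_sum]
    rw [h1, map_add, map_sum, map_smul]
    simp only [map_smul, smul_eq_mul, dotProduct, y, μ]
    rw [mul_comm r]
    congr 1
    exact Finset.sum_congr rfl fun i _ => mul_comm _ _
  have hu0 : u < 0 := by
    have := hφ (T' 0) ⟨0, ⟨h0, le_refl (0 : ℝ)⟩, rfl⟩
    simpa using this
  have hpos : ∀ q ∈ Q, ∀ r : ℝ, 0 ≤ r → 0 ≤ y ⬝ᵥ T q + μ * (o q + r) := by
    intro q hq r hr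
    by_contra! hneg
    -- Scaling by this factor moves the value of `φ` to exactly `u`, against the strict separation.
    have ht : 0 < u / (y ⬝ᵥ T q + μ * (o q + r)) := div_pos_of_neg_of_neg hu0 hneg
    have := hφ _ ⟨(_ • q, _ * r), ⟨hsmul _ ht q hq, mul_nonneg ht.le hr⟩, rfl⟩
    rw [hT', hφe] at this
    simp only [map_smul, dotProduct_smul, smul_eq_mul] at this
    rw [← mul_add, mul_left_comm, ← mul_add, div_mul_cancel₀ _ hneg.ne] at this
    exact lt_irrefl _ this
  have hμ : 0 ≤ μ := by simpa using hpos 0 h0 1 zero_le_one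
  have hlt : -(y ⬝ᵥ f) - μ * p < 0 := by
    have := hu.trans hu0
    rw [hφe, dotProduct_neg] at this
    linarith
  rcases hμ.eq_or_lt with hμ0 | hμ0
  -- Vertical case: `-y` is a recession direction of the primal feasible set along which the cost
  -- strictly decreases. Following it from the Slater point violates the lower bound `p`.
  · rw [← hμ0] at hlt hpos
    have hfy : 0 < f ⬝ᵥ y := by rw [dotProduct_comm]; linarith
    have key : ∀ t : ℝ, 0 ≤ t → p ≤ f ⬝ᵥ xs - t * (f ⬝ᵥ y) := by
      intro t ht
      have := hp (xs - t • y) ?_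
      · simpa [dotProduct_sub, dotProduct_smul] using this
      · intro q hq
        have h1 := hslater q hq
        have h2 := hpos q hq 0 le_rfl
        rw [sub_dotProduct, smul_dotProduct, smul_eq_mul]
        have h3 : 0 ≤ t * (y ⬝ᵥ T q) := mul_nonneg ht (by linarith)
        have h4 : 0 ≤ ε * ‖q‖ := by positivity
        linarith
    have h1 := key 0 le_rfl
    -- With this step length `key` reads `p ≤ p - 1`.
    have h2 := key ((f ⬝ᵥ xs - p + 1) / (f ⬝ᵥ y)) (div_nonneg (by linarith) hfy.le)
    rw [div_mul_cancel₀ _ hfy.ne'] at h2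
    linarith
  -- Normalizing the separating functional gives a primal feasible point of cost below `p`.
  · have := hp (-(μ⁻¹ • y)) ?_
    · rw [dotProduct_neg, dotProduct_smul, smul_eq_mul, dotProduct_comm] at this
      have h2 := mul_le_mul_of_nonneg_left this hμ
      rw [mul_neg, mul_inv_cancel_left₀ hμ0.ne'] at h2
      linarith
    · intro q hq
      have h1 := hpos q hq 0 le_rfl
      rw [neg_dotProduct, smul_dotProduct, smul_eq_mul, neg_le_iff_add_nonneg]
      have h2 := mul_nonneg (inv_nonneg.2 hμ) h1
      rw [mul_add, add_zero, inv_mul_cancel_left₀ hμ0.ne'] at h2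
      linarith

/-! ### Cones over compact convex sets -/

/-- The cone `{(s ξ, s) : s ≥ 0, ξ ∈ C}` over a set `C`, with the apex always included. -/
def perspectiveCone {W : Type*} [AddCommGroup W] [Module ℝ W] (C : Set W) : Set (W × ℝ) :=
  {q | q = 0 ∨ 0 ≤ q.2 ∧ ∃ ξ ∈ C, q.1 = q.2 • ξ}

/-- Without the apex, the cone is the projection along the compact factor `C` of a closed set of
triples `(ζ, s, ξ)`, and such projections are closed maps. -/
theorem isClosed_perspectiveCone {W : Type*} [NormedAddCommGroup W] [NormedSpace ℝ W]
    {C : Set W} (hC : IsCompact C) : IsClosed (perspectiveCone C) := by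
  have h1 : IsClosed {q : W × ℝ | 0 ≤ q.2 ∧ ∃ ξ ∈ C, q.1 = q.2 • ξ} := by
    have : CompactSpace C := isCompact_iff_compactSpace.1 hC
    have h2 : IsClosed {q : (W × ℝ) × C | 0 ≤ q.1.2 ∧ q.1.1 = q.1.2 • (q.2 : W)} :=
      (isClosed_le continuous_const (continuous_snd.comp continuous_fst)).inter
        (isClosed_eq (continuous_fst.comp continuous_fst)
          ((continuous_snd.comp continuous_fst).smul (continuous_subtype_val.comp continuous_snd)))
    have h3 := isClosedMap_fst_of_compactSpace _ h2
    convert h3 using 1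
    ext q
    simp
  have : perspectiveCone C = {0} ∪ {q : W × ℝ | 0 ≤ q.2 ∧ ∃ ξ ∈ C, q.1 = q.2 • ξ} := rfl
  rw [this]
  exact isClosed_singleton.union h1

theorem smul_mem_perspectiveCone {W : Type*} [AddCommGroup W] [Module ℝ W] {C : Set W} {t : ℝ}
    (ht : 0 ≤ t) {q : W × ℝ} (hq : q ∈ perspectiveCone C) : t • q ∈ perspectiveCone C := by
  rcases hq with rfl | ⟨h, ξ, hξ, he⟩
  · exact Or.inl (smul_zero _)
  · exact Or.inr ⟨mul_nonneg ht h, ξ, hξ, by simp [he, mul_smul]⟩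

theorem add_mem_perspectiveCone {W : Type*} [AddCommGroup W] [Module ℝ W] {C : Set W}
    (hC : Convex ℝ C) {q q' : W × ℝ} (hq : q ∈ perspectiveCone C)
    (hq' : q' ∈ perspectiveCone C) : q + q' ∈ perspectiveCone C := by
  rcases hq with rfl | ⟨h, ξ, hξ, he⟩
  · rwa [zero_add]
  rcases hq' with rfl | ⟨h', ξ', hξ', he'⟩
  · rw [add_zero]; exact Or.inr ⟨h, ξ, hξ, he⟩
  rcases (add_nonneg h h').eq_or_lt with h0 | hpos
  · have h1 : q.2 = 0 := by linarith
    have h2 : q'.2 = 0 := by linarith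
    left
    ext
    · simp [he, he', h1, h2]
    · simp [h1, h2]
  -- The base point of the sum is the average of the two base points, weighted by the scales.
  · refine Or.inr ⟨hpos.le, (q.2 / (q.2 + q'.2)) • ξ + (q'.2 / (q.2 + q'.2)) • ξ',
      hC hξ hξ' (by positivity) (by positivity) (by field_simp), ?_⟩
    simp only [Prod.fst_add, Prod.snd_add, smul_add, smul_smul]
    rw [mul_div_cancel₀ _ hpos.ne', mul_div_cancel₀ _ hpos.ne', he, he']

theorem convex_perspectiveCone {W : Type*} [AddCommGroup W] [Module ℝ W] {C : Set W}
    (hC : Convex ℝ C) : Convex ℝ (perspectiveCone C) :=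
  fun _ hq _ hq' _ _ ha hb _ => add_mem_perspectiveCone hC (smul_mem_perspectiveCone ha hq)
    (smul_mem_perspectiveCone hb hq')

/-! ### Compact convex hulls and telescoping sums -/

theorem Function.Embedding.sum_eq_sum_comp {ι κ M : Type*} [Fintype ι] [Fintype κ]
    [AddCommMonoid M] (e : ι ↪ κ) (v : κ → M) (hv : ∀ i, i ∉ Set.range e → v i = 0) :
    ∑ i, v i = ∑ j, v (e j) :=
  (Finset.sum_of_injOn e e.injective.injOn (by simp) (fun i _ hi => hv i (by simpa using hi))
    (by simp)).symm

/-- In a finite-dimensional space the convex hull of a compact set is compact. -/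
theorem IsCompact.convexHull_of_finiteDimensional {E : Type*} [NormedAddCommGroup E]
    [NormedSpace ℝ E] [FiniteDimensional ℝ E] {C : Set E} (hC : IsCompact C) :
    IsCompact (convexHull ℝ C) := by
  rcases C.eq_empty_or_nonempty with rfl | ⟨c, hc⟩
  · simp
  let n := Module.finrank ℝ E + 1
  let Φ : (Fin n → ℝ) × (Fin n → E) → E := fun q => ∑ i, q.1 i • q.2 i
  have hΦ : Continuous Φ := by fun_prop
  -- Carathéodory: `dim + 1` points suffice. Shorter combinations are padded with the point `c` at
  -- weight zero.
  have himg : convexHull ℝ C = Φ '' (stdSimplex ℝ (Fin n) ×ˢ Set.univ.pi fun _ => C) := by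
    apply Set.Subset.antisymm
    · intro x hx
      obtain ⟨ι, _, z, w, hz, hind, hw, hw1, hx⟩ := eq_pos_convex_span_of_mem_convexHull hx
      have hcard : Fintype.card ι ≤ Fintype.card (Fin n) := by
        rw [Fintype.card_fin]
        exact hind.card_le_finrank_succ.trans
          (Nat.succ_le_succ (Submodule.finrank_le _))
      obtain ⟨e⟩ := Function.Embedding.nonempty_of_card_le hcard
      refine ⟨(Function.extend e w 0, Function.extend e z fun _ => c), ⟨⟨fun i => ?_, ?_⟩, ?_⟩, ?_⟩
      · by_cases hi : ∃ j, e j = i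
        · obtain ⟨j, rfl⟩ := hi
          simpa [e.injective.extend_apply] using (hw j).le
        · simp [Function.extend_apply' _ _ _ hi]
      · rw [e.sum_eq_sum_comp _ fun i hi => Function.extend_apply' (f := e) w (0 : Fin n → ℝ) i hi]
        simpa [e.injective.extend_apply] using hw1
      · intro i _
        by_cases hi : ∃ j, e j = i
        · obtain ⟨j, rfl⟩ := hi
          simpa [e.injective.extend_apply] using hz (Set.mem_range_self j)
        · simpa [Function.extend_apply' _ _ _ hi] using hc
      · change ∑ i, _ = _
        rw [e.sum_eq_sum_comp _ fun i hi => by simp [Function.extend_apply' _ _ _ hi]]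
        simpa [e.injective.extend_apply] using hx
    · rintro _ ⟨⟨w, z⟩, ⟨⟨hw, hw1⟩, hz⟩, rfl⟩
      exact (convex_convexHull ℝ C).sum_mem (fun i _ => hw i) hw1
        fun i _ => subset_convexHull ℝ C (hz i trivial)
  rw [himg]
  exact ((isCompact_stdSimplex ℝ (Fin n)).prod (isCompact_univ_pi fun _ => hC)).image hΦ

theorem Fin.sum_succ_sub_castSucc {n : ℕ} (u : Fin (n + 1) → ℝ) :
    ∑ j : Fin n, (u j.succ - u j.castSucc) = u (Fin.last n) - u 0 := by
  induction n with
  | zero => simp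
  | succ n ih =>
    rw [Fin.sum_univ_castSucc]
    have := ih fun j => u j.castSucc
    simp only [Fin.succ_castSucc] at this ⊢
    rw [this]
    simp
end

/-! ### Folding, retraction and the lifted supports -/

noncomputable section
namespace MultistageProblem

variable (S : MultistageProblem)

theorem z_castSucc_lt_succ (l : S.LiftIdx) : S.z l.1 l.2.castSucc < S.z l.1 l.2.succ :=
  S.z_strictMono l.1 Fin.castSucc_lt_succ

/-- As a difference of truncations the folding is visibly continuous, and its sum over the pieces
telescopes. -/
theorem fold_apply (θ : Fin S.I → ℝ) (l : S.LiftIdx) :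
    S.fold θ l = min (θ l.1) (S.z l.1 l.2.succ) - min (θ l.1) (S.z l.1 l.2.castSucc) := by
  have hz := S.z_castSucc_lt_succ l
  unfold fold
  split_ifs with h1 h2
  · rw [min_eq_left h1.le, min_eq_left (h1.trans hz).le, sub_self]
  · rw [min_eq_left h2, min_eq_right (not_lt.1 h1)]
  · rw [min_eq_right (not_le.1 h2).le, min_eq_right (not_lt.1 h1)]

theorem continuous_fold : Continuous S.fold := by
  refine continuous_pi fun l => ?_
  simp only [fold_apply]
  fun_prop

theorem fold_mem_Icc (θ : Fin S.I → ℝ) :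
    S.fold θ ∈ Set.Icc 0 fun l : S.LiftIdx => S.z l.1 l.2.succ - S.z l.1 l.2.castSucc := by
  refine ⟨fun l => ?_, fun l => ?_⟩ <;>
  · have hz := S.z_castSucc_lt_succ l
    unfold fold
    split_ifs <;> simp only [Pi.zero_apply] <;> linarith

theorem unfold_fold {θ : Fin S.I → ℝ} (h0 : ∀ i, S.z i 0 ≤ θ i)
    (h1 : ∀ i, θ i ≤ S.z i (Fin.last _)) : S.unfold (S.fold θ) = θ := by
  ext i
  simp only [unfold, fold_apply]
  rw [Fin.sum_succ_sub_castSucc fun j => min (θ i) (S.z i j), min_eq_left (h1 i),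
    min_eq_right (h0 i)]
  ring

theorem isCompact_Θ (g : Fin S.G) : IsCompact (S.Θ g) :=
  (S.isCompact_Ψ g).image S.E.mulVecLin.continuous_of_finiteDimensional

theorem convex_Θ {g : Fin S.G} (h : Convex ℝ (S.Ψ g)) : Convex ℝ (S.Θ g) :=
  h.linear_image S.E.mulVecLin

theorem Θ_subset_box (g : Fin S.G) : S.Θ g ⊆ S.box g := by
  intro θ hθ
  have hc : ∀ i, IsCompact ((fun θ : Fin S.I → ℝ => θ i) '' S.Θ g) := fun i =>
    (S.isCompact_Θ g).image (continuous_apply i)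
  exact ⟨fun i => csInf_le (hc i).bddBelow (Set.mem_image_of_mem _ hθ),
    fun i => le_csSup (hc i).bddAbove (Set.mem_image_of_mem _ hθ)⟩

/-- The lift of any point of `Ψ g` belongs to the set. This supplies the base point that
`dualFeasible` demands even at scale zero. -/
theorem nonempty_outer (g : Fin S.G) : (S.outer g).Nonempty := by
  obtain ⟨u, hu⟩ := S.nonempty_Ψ g
  have hθ : S.E.mulVec u ∈ S.Θ g := Set.mem_image_of_mem _ hu
  have hmem : u ∈ ⋃ g, S.Ψ g := Set.mem_iUnion_of_mem g hu
  refine ⟨S.fold (S.E.mulVec u), ?_,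
    subset_convexHull ℝ _ (Set.mem_image_of_mem _ (S.Θ_subset_box g hθ))⟩
  change S.unfold _ ∈ S.Θ g
  rwa [S.unfold_fold (fun i => (S.z_zero i).2 (Set.mem_image_of_mem _ hmem))
    fun i => (S.z_last i).2 (Set.mem_image_of_mem _ hmem)]

/-- The linear part of the unfolding operator. -/
def unfoldLin : (S.LiftIdx → ℝ) →ₗ[ℝ] (Fin S.I → ℝ) where
  toFun ξ i := ∑ j, ξ ⟨i, j⟩
  map_add' ξ ξ' := by ext i; simp [Finset.sum_add_distrib]
  map_smul' t ξ := by ext i; simp [Finset.mul_sum]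

theorem unfold_eq (ξ : S.LiftIdx → ℝ) : S.unfold ξ = S.unfoldLin ξ + fun i => S.z i 0 := by
  ext i
  exact add_comm _ _

theorem continuous_unfold : Continuous S.unfold := by
  unfold unfold
  fun_prop

theorem retr_eq (ξ : S.LiftIdx → ℝ) :
    S.retr ξ = S.Eplus.mulVecLin (S.unfoldLin ξ) + S.retr 0 := by
  simp [retr, unfold_eq, Matrix.mulVec_add]

theorem continuous_retr : Continuous S.retr :=
  S.Eplus.mulVecLin.continuous_of_finiteDimensional.comp S.continuous_unfold

theorem isCompact_outer (g : Fin S.G) : IsCompact (S.outer g) := by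
  have hc : IsCompact (S.fold '' S.box g) := isCompact_Icc.image S.continuous_fold
  exact hc.convexHull_of_finiteDimensional.inter_left
    ((S.isCompact_Θ g).isClosed.preimage S.continuous_unfold)

theorem convex_outer {g : Fin S.G} (h : Convex ℝ (S.Ψ g)) : Convex ℝ (S.outer g) := by
  have h1 := (S.convex_Θ h).affine_preimage
    (S.unfoldLin.toAffineMap + AffineMap.const ℝ _ fun i => S.z i 0)
  refine Convex.inter ?_ (convex_convexHull ℝ _)
  have heq : {ξ | S.unfold ξ ∈ S.Θ g} = (S.unfoldLin.toAffineMap +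
      AffineMap.const ℝ _ fun i => S.z i 0 : (S.LiftIdx → ℝ) →ᵃ[ℝ] _) ⁻¹' S.Θ g := by
    ext ξ
    change S.unfold ξ ∈ S.Θ g ↔ _
    rw [unfold_eq]
    rfl
  rw [heq]
  exact h1

/-- The linear part of the lifted grid distance. -/
def dLin (zl zu : Fin S.I → ℝ) : (S.LiftIdx → ℝ) →ₗ[ℝ] ℝ where
  toFun ξ := ∑ i, ((∑ j with zu i < S.z i (Fin.succ j), ξ ⟨i, j⟩)
    - ∑ j with S.z i (Fin.succ j) ≤ zl i, ξ ⟨i, j⟩)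
  map_add' ξ ξ' := by
    rw [← Finset.sum_add_distrib]
    refine Finset.sum_congr rfl fun i _ => ?_
    simp only [Pi.add_apply, Finset.sum_add_distrib]
    ring
  map_smul' t ξ := by
    simp [Finset.mul_sum, mul_sub]

theorem d'_eq (ξ : S.LiftIdx → ℝ) (zl zu : Fin S.I → ℝ) :
    S.d' ξ zl zu = S.dLin zl zu ξ + ∑ i, (zl i - S.z i 0) := by
  simp only [d', dLin, LinearMap.coe_mk, AddHom.coe_mk]
  rw [← Finset.sum_add_distrib]
  exact Finset.sum_congr rfl fun i _ => by ring

theorem refined_eq (g : Fin S.G) : S.refined g = S.outer g ∩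
    ⋂ (zl) (zu) (_ : zl ∈ S.grid ∧ zu ∈ S.grid ∧ zl ≤ zu),
      {ξ | S.dLin zl zu ξ ≤ S.dbar g zl zu - ∑ i, (zl i - S.z i 0)} := by
  ext ξ
  simp only [refined, d'_eq, Set.mem_ofPred_eq, Set.mem_inter_iff, Set.mem_iInter, and_imp,
    le_sub_iff_add_le]
  exact and_congr_right fun _ =>
    ⟨fun h zl zu h1 h2 h3 => h zl h1 zu h2 h3, fun h zl h1 zu h2 h3 => h zl zu h1 h2 h3⟩

theorem isCompact_refined (g : Fin S.G) : IsCompact (S.refined g) := by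
  rw [refined_eq]
  exact (S.isCompact_outer g).inter_right (isClosed_iInter fun zl => isClosed_iInter fun zu =>
    isClosed_iInter fun _ =>
      isClosed_le (S.dLin zl zu).continuous_of_finiteDimensional continuous_const)

theorem convex_refined {g : Fin S.G} (h : Convex ℝ (S.Ψ g)) : Convex ℝ (S.refined g) := by
  rw [refined_eq]
  exact (S.convex_outer h).inter (convex_iInter fun zl => convex_iInter fun zu =>
    convex_iInter fun _ => convex_halfSpace_le (S.dLin zl zu).isLinear _)

/-! ### Decision rules and the conic program in coefficients -/

/-- Index set of the coefficients of affine decision rules. -/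
abbrev CoefIdx : Type := Fin S.D ⊕ (Fin S.D × S.LiftIdx)

open Classical in
/-- The left-hand sides of the equality constraints of the conic program. -/
def coefMap : S.DualVar →ₗ[ℝ] (S.CoefIdx → ℝ) where
  toFun v := ∑ g, ∑ k, Sum.elim (fun d => v.2 g k * S.A g k d)
    fun p => if S.Observes p.1 p.2.1 then S.A g k p.1 * v.1 g k p.2 else 0
  map_add' v w := by
    simp only [← Finset.sum_add_distrib]
    refine Finset.sum_congr rfl fun g _ => Finset.sum_congr rfl fun k _ => ?_
    ext (d | p)
    · simp [add_mul]
    · by_cases h : S.Observes p.1 p.2.1 <;> simp [h, mul_add]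
  map_smul' t v := by
    simp only [Finset.smul_sum]
    refine Finset.sum_congr rfl fun g _ => Finset.sum_congr rfl fun k _ => ?_
    ext (d | p)
    · simp [mul_assoc]
    · by_cases h : S.Observes p.1 p.2.1 <;> simp [h, mul_left_comm]

open Classical in
/-- The objective coefficients of the affine decision rule problem. -/
def costVec : S.CoefIdx → ℝ :=
  Sum.elim (fun d => ∫ ξ, S.c (S.retr ξ) d ∂S.P')
    fun p => if S.Observes p.1 p.2.1 then ∫ ξ, S.c (S.retr ξ) p.1 * ξ p.2 ∂S.P' else 0

/-- Entries at inadmissible pairs are zero on both sides and impose nothing. -/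
theorem coefMap_eq_neg_costVec_iff (v : S.DualVar) : S.coefMap v = -S.costVec ↔
    (∀ (d : Fin S.D) (l : S.LiftIdx), S.Observes d l.1 →
      ∑ g, ∑ k, S.A g k d * v.1 g k l = -∫ ξ, S.c (S.retr ξ) d * ξ l ∂S.P') ∧
    ∀ d : Fin S.D, ∑ g, ∑ k, v.2 g k * S.A g k d = -∫ ξ, S.c (S.retr ξ) d ∂S.P' := by
  simp only [coefMap, costVec, LinearMap.coe_mk, AddHom.coe_mk]
  rw [funext_iff, Sum.forall, and_comm]
  refine and_congr ?_ (forall_congr' fun d => by simp [Finset.sum_apply])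
  rw [Prod.forall]
  refine forall_congr' fun d => forall_congr' fun l => ?_
  by_cases h : S.Observes d l.1 <;> simp [h, Finset.sum_apply]

/-- The linear part of a constraint right-hand side as a function of the lifted parameters. -/
def rhsLin (g : Fin S.G) (k : Fin (S.K g)) : (S.LiftIdx → ℝ) →ₗ[ℝ] ℝ :=
  LinearMap.proj k ∘ₗ (S.b g).linear ∘ₗ S.Eplus.mulVecLin ∘ₗ S.unfoldLin

theorem b_retr (g : Fin S.G) (k : Fin (S.K g)) (ξ : S.LiftIdx → ℝ) :
    S.b g (S.retr ξ) k = S.rhsLin g k ξ + S.b g (S.retr 0) k := by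
  rw [retr_eq]
  have := (S.b g).map_vadd (S.retr 0) (S.Eplus.mulVecLin (S.unfoldLin ξ))
  rw [vadd_eq_add, vadd_eq_add] at this
  rw [this]
  rfl

/-- The negative of the objective function of the conic program, which is linear. -/
def homObj : S.DualVar →ₗ[ℝ] ℝ where
  toFun v := ∑ g, ∑ k, (S.rhsLin g k (v.1 g k) + v.2 g k * S.b g (S.retr 0) k)
  map_add' v w := by
    simp only [← Finset.sum_add_distrib]
    refine Finset.sum_congr rfl fun g _ => Finset.sum_congr rfl fun k _ => ?_
    simp only [Prod.fst_add, Prod.snd_add, Pi.add_apply, map_add]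
    ring
  map_smul' t v := by
    simp only [Finset.smul_sum]
    refine Finset.sum_congr rfl fun g _ => Finset.sum_congr rfl fun k _ => ?_
    simp only [Prod.smul_fst, Prod.smul_snd, Pi.smul_apply, map_smul, smul_eq_mul,
      RingHom.id_apply]
    ring

/-- The summand `(s - 1) * b (R 0)` turns the constant of the affine map `b ∘ R` into a term linear
in `s`. -/
theorem dualObj_eq (v : S.DualVar) : S.dualObj v = -S.homObj v := by
  simp only [dualObj, homObj, LinearMap.coe_mk, AddHom.coe_mk]
  congr 1
  refine Finset.sum_congr rfl fun g _ => Finset.sum_congr rfl fun k _ => ?_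
  rw [S.b_retr g k (v.1 g k)]
  ring

open Classical in
/-- The linear part of the decision rule with the given coefficients. -/
def policyLin (y : S.CoefIdx → ℝ) : (S.LiftIdx → ℝ) →ₗ[ℝ] (Fin S.D → ℝ) where
  toFun ξ d := ∑ l, if S.Observes d l.1 then y (Sum.inr (d, l)) * ξ l else 0
  map_add' ξ ξ' := by
    ext d
    simp only [Pi.add_apply, ← Finset.sum_add_distrib]
    refine Finset.sum_congr rfl fun l _ => ?_
    split_ifs <;> simp [mul_add]
  map_smul' t ξ := by
    ext d
    simp only [Pi.smul_apply, smul_eq_mul, Finset.mul_sum, RingHom.id_apply]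
    refine Finset.sum_congr rfl fun l _ => ?_
    split_ifs <;> simp [mul_left_comm]

/-- The affine decision rule with the given coefficients. -/
def policy (y : S.CoefIdx → ℝ) : S.Policy :=
  (S.policyLin y).toAffineMap + AffineMap.const ℝ _ fun d => y (Sum.inl d)

theorem policy_apply (y : S.CoefIdx → ℝ) (ξ : S.LiftIdx → ℝ) :
    S.policy y ξ = S.policyLin y ξ + fun d => y (Sum.inl d) := rfl

theorem nonAnticipative_policy (y : S.CoefIdx → ℝ) : S.NonAnticipative (S.policy y) := by
  intro d ξ ξ' h
  simp only [policy_apply, Pi.add_apply, policyLin, LinearMap.coe_mk, AddHom.coe_mk]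
  congr 1
  refine Finset.sum_congr rfl fun l _ => ?_
  split_ifs with hl
  · rw [h l hl]
  · rfl

/-- The coefficient at `l` is the increment of `x` from `0` to the `l`-th unit vector; for
unobserved `l` non-anticipativity makes it vanish, matching the convention in `policyLin`. -/
theorem NonAnticipative.exists_policy {x : S.Policy} (hx : S.NonAnticipative x) :
    ∃ y, S.policy y = x := by
  classical
  refine ⟨Sum.elim (fun d => x 0 d) fun p => x (Pi.single p.2 1) p.1 - x 0 p.1, ?_⟩
  ext ξ d
  have hlin : ∀ w, x.linear w = x w - x 0 := fun w => by
    simpa using x.linearMap_vsub w 0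
  have h1 : x ξ = x.linear ξ + x 0 := by rw [hlin]; simp
  rw [h1, LinearMap.pi_apply_eq_sum_univ x.linear ξ, policy_apply]
  simp only [policyLin, LinearMap.coe_mk, AddHom.coe_mk, Pi.add_apply, Sum.elim_inl,
    Sum.elim_inr, Finset.sum_apply, Pi.smul_apply, smul_eq_mul]
  congr 1
  refine Finset.sum_congr rfl fun l _ => ?_
  have h2 : (fun j => if l = j then (1 : ℝ) else 0) = Pi.single l 1 := by
    ext j
    simp [Pi.single_apply, eq_comm]
  rw [h2, hlin, Pi.sub_apply]
  split_ifs with hl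
  · ring
  · rw [hx d (Pi.single l 1) 0, sub_self, mul_zero]
    intro l' hl'
    rw [Pi.single_eq_of_ne (by rintro rfl; exact hl hl'), Pi.zero_apply]

/-- The slack of a constraint under an affine decision rule, homogenized. -/
def slack (y : S.CoefIdx → ℝ) (g : Fin S.G) (k : Fin (S.K g)) (ζ : S.LiftIdx → ℝ) (s : ℝ) : ℝ :=
  S.rhsLin g k ζ + s * S.b g (S.retr 0) k
    - ((S.A g).mulVec (S.policyLin y ζ) k + s * (S.A g).mulVec (fun d => y (Sum.inl d)) k)

theorem slack_zero (y : S.CoefIdx → ℝ) (g : Fin S.G) (k : Fin (S.K g)) :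
    S.slack y g k 0 0 = 0 := by
  simp [slack]

theorem slack_smul (y : S.CoefIdx → ℝ) (g : Fin S.G) (k : Fin (S.K g)) (ξ : S.LiftIdx → ℝ)
    (s : ℝ) : S.slack y g k (s • ξ) s =
      s * (S.b g (S.retr ξ) k - (S.A g).mulVec (S.policy y ξ) k) := by
  rw [slack, S.b_retr g k ξ, policy_apply, Matrix.mulVec_add, map_smul, map_smul, Matrix.mulVec_smul]
  simp only [Pi.add_apply, Pi.smul_apply, smul_eq_mul]
  ring

/-- The Lagrangian identity behind both weak duality and the Slater estimate: the gap splits into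
one slack per constraint. -/
theorem homObj_sub_dotProduct (y : S.CoefIdx → ℝ) (v : S.DualVar) :
    S.homObj v - y ⬝ᵥ S.coefMap v = ∑ g, ∑ k, S.slack y g k (v.1 g k) (v.2 g k) := by
  simp only [homObj, coefMap, LinearMap.coe_mk, AddHom.coe_mk, dotProduct_sum,
    ← Finset.sum_sub_distrib]
  refine Finset.sum_congr rfl fun g _ => Finset.sum_congr rfl fun k _ => ?_
  rw [slack]
  congr 1
  rw [dotProduct, Fintype.sum_sum_type, Fintype.sum_prod_type, add_comm]
  simp only [Matrix.mulVec, dotProduct, Sum.elim_inl, Sum.elim_inr, policyLin, LinearMap.coe_mk,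
    AddHom.coe_mk, Finset.mul_sum]
  congr 1
  · refine Finset.sum_congr rfl fun d _ => Finset.sum_congr rfl fun l _ => ?_
    split_ifs <;> ring
  · exact Finset.sum_congr rfl fun d _ => by ring

/-! ### The dual cone and primal feasibility -/

/-- The conic constraints of the dual program over a family of supports. -/
def dualCone (U : Fin S.G → Set (S.LiftIdx → ℝ)) : Set S.DualVar :=
  {v | ∀ g k, (v.1 g k, v.2 g k) ∈ perspectiveCone (U g)}

variable {S} {U : Fin S.G → Set (S.LiftIdx → ℝ)}

theorem isClosed_dualCone (hU : ∀ g, IsCompact (U g)) : IsClosed (S.dualCone U) := by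
  have : S.dualCone U = ⋂ (g) (k), (fun v : S.DualVar => (v.1 g k, v.2 g k)) ⁻¹'
      perspectiveCone (U g) := by
    ext v
    simp [dualCone]
  rw [this]
  exact isClosed_iInter fun g => isClosed_iInter fun k =>
    (isClosed_perspectiveCone (hU g)).preimage (by fun_prop)

theorem convex_dualCone (hU : ∀ g, Convex ℝ (U g)) : Convex ℝ (S.dualCone U) :=
  fun _ hv _ hw _ _ ha hb hab g k => convex_perspectiveCone (hU g) (hv g k) (hw g k) ha hb hab

theorem smul_mem_dualCone {t : ℝ} (ht : 0 ≤ t) {v : S.DualVar} (hv : v ∈ S.dualCone U) :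
    t • v ∈ S.dualCone U :=
  fun g k => smul_mem_perspectiveCone ht (hv g k)

theorem slack_nonneg {y : S.CoefIdx → ℝ} (hy : S.policy y ∈ S.affFeasible U) {g : Fin S.G}
    {k : Fin (S.K g)} {ζ : S.LiftIdx → ℝ} {s : ℝ} (h : (ζ, s) ∈ perspectiveCone (U g)) :
    0 ≤ S.slack y g k ζ s := by
  rcases h with h | ⟨hs, ξ, hξ, he⟩
  · obtain ⟨rfl, rfl⟩ := Prod.mk.inj h
    rw [slack_zero]
  · change ζ = s • ξ at he
    rw [he, slack_smul]
    exact mul_nonneg hs (sub_nonneg.2 (hy.2 g ξ hξ k))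

theorem slack_pos {y : S.CoefIdx → ℝ} (hy : S.IsSlaterPoint U (S.policy y)) {g : Fin S.G}
    {k : Fin (S.K g)} {ζ : S.LiftIdx → ℝ} {s : ℝ} (h : (ζ, s) ∈ perspectiveCone (U g))
    (h0 : (ζ, s) ≠ 0) : 0 < S.slack y g k ζ s := by
  rcases h with h | ⟨hs, ξ, hξ, he⟩
  · exact absurd h h0
  · change ζ = s • ξ at he
    have hs0 : s ≠ 0 := by
      rintro rfl
      exact h0 (by simp [he])
    rw [he, slack_smul]
    exact mul_pos (lt_of_le_of_ne hs hs0.symm) (sub_pos.2 (hy.2 g ξ hξ k))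

theorem IsSlaterPoint.mem_affFeasible {x : S.Policy} (hx : S.IsSlaterPoint U x) :
    x ∈ S.affFeasible U :=
  ⟨hx.1, fun g ξ hξ k => (hx.2 g ξ hξ k).le⟩

theorem dotProduct_coefMap_le {y : S.CoefIdx → ℝ} (hy : S.policy y ∈ S.affFeasible U)
    {v : S.DualVar} (hv : v ∈ S.dualCone U) : y ⬝ᵥ S.coefMap v ≤ S.homObj v := by
  rw [← sub_nonneg, homObj_sub_dotProduct]
  exact Finset.sum_nonneg fun g _ => Finset.sum_nonneg fun k _ => slack_nonneg hy (hv g k)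

theorem dotProduct_coefMap_lt {y : S.CoefIdx → ℝ} (hy : S.IsSlaterPoint U (S.policy y))
    {v : S.DualVar} (hv : v ∈ S.dualCone U) (h0 : v ≠ 0) : y ⬝ᵥ S.coefMap v < S.homObj v := by
  rw [← sub_pos, homObj_sub_dotProduct]
  have hnn : ∀ g k, 0 ≤ S.slack y g k (v.1 g k) (v.2 g k) := fun g k =>
    slack_nonneg hy.mem_affFeasible (hv g k)
  obtain ⟨g, k, hgk⟩ : ∃ g k, (v.1 g k, v.2 g k) ≠ 0 := by
    by_contra! h
    apply h0
    ext g k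
    · exact congrFun (congrArg Prod.fst (h g k)) _
    · exact congrArg Prod.snd (h g k)
  refine Finset.sum_pos' (fun g _ => Finset.sum_nonneg fun k _ => hnn g k)
    ⟨g, Finset.mem_univ _, ?_⟩
  exact Finset.sum_pos' (fun k _ => hnn g k) ⟨k, Finset.mem_univ _, slack_pos hy (hv g k) hgk⟩

theorem policy_mem_affFeasible {y : S.CoefIdx → ℝ}
    (hy : ∀ v ∈ S.dualCone U, y ⬝ᵥ S.coefMap v ≤ S.homObj v) :
    S.policy y ∈ S.affFeasible U := by
  refine ⟨S.nonAnticipative_policy y, fun g ξ hξ k => ?_⟩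
  -- Testing with `(ξ, 1)` in block `(g, k)` and the apex elsewhere isolates a single constraint at
  -- `ξ`.
  have hv : ((Pi.single g (Pi.single k ξ), Pi.single g (Pi.single k 1)) : S.DualVar) ∈
      S.dualCone U := by
    intro g' k'
    by_cases hg : g' = g
    · subst hg
      by_cases hk : k' = k
      · subst hk
        exact Or.inr ⟨by simp, ξ, hξ, by simp⟩
      · exact Or.inl (by simp [hk])
    · exact Or.inl (by simp [hg])
  have h := hy _ hv
  rw [← sub_nonneg, homObj_sub_dotProduct, Finset.sum_eq_single g, Finset.sum_eq_single k] at h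
  · have h1 := S.slack_smul y g k ξ 1
    rw [one_smul, one_mul] at h1
    simp only [Pi.single_eq_same] at h
    rw [h1] at h
    exact sub_nonneg.1 h
  · intro k' _ hk
    simp [hk, slack_zero]
  · simp
  · intro g' _ hg
    simp [hg, slack_zero]
  · simp

/-! ### Integrability and the expected cost -/

variable (S)

instance : IsFiniteMeasure S.P' := by
  have := S.isProbabilityMeasure_P
  unfold P'
  infer_instance

theorem ae_mem_Icc : ∀ᵐ ξ ∂S.P',
    ξ ∈ Set.Icc 0 fun l : S.LiftIdx => S.z l.1 l.2.succ - S.z l.1 l.2.castSucc := by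
  have hm : Measurable S.lift :=
    (S.continuous_fold.comp S.E.mulVecLin.continuous_of_finiteDimensional).measurable
  refine (ae_map_iff hm.aemeasurable ?_).2 (Filter.Eventually.of_forall fun u => S.fold_mem_Icc _)
  exact measurableSet_Icc

/-- Folding takes values in a fixed compact box, on which the finite measure `P'` is concentrated.
-/
theorem integrable_P' {h : (S.LiftIdx → ℝ) → ℝ} (hh : Continuous h) : Integrable h S.P' := by
  rw [← Measure.restrict_eq_self_of_ae_mem S.ae_mem_Icc]
  exact hh.continuousOn.integrableOn_compact isCompact_Icc

theorem cost_policy (y : S.CoefIdx → ℝ) : S.cost (S.policy y) = S.costVec ⬝ᵥ y := by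
  classical
  have hc : ∀ d, Continuous fun ξ => S.c (S.retr ξ) d := fun d =>
    (continuous_apply d).comp (S.c.continuous_of_finiteDimensional.comp S.continuous_retr)
  have h1 : ∀ ξ, S.c (S.retr ξ) ⬝ᵥ S.policy y ξ = ∑ d, (S.c (S.retr ξ) d * y (Sum.inl d) +
      ∑ l : S.LiftIdx, (S.c (S.retr ξ) d * ξ l) *
        if S.Observes d l.1 then y (Sum.inr (d, l)) else 0) := by
    intro ξ
    refine Finset.sum_congr rfl fun d _ => ?_
    simp only [policy_apply, policyLin, LinearMap.coe_mk, AddHom.coe_mk, Pi.add_apply, mul_add,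
      Finset.mul_sum]
    rw [add_comm]
    congr 1
    refine Finset.sum_congr rfl fun l _ => ?_
    split_ifs <;> ring
  have hi1 : ∀ d, Integrable (fun ξ => S.c (S.retr ξ) d * y (Sum.inl d)) S.P' := fun d =>
    S.integrable_P' ((hc d).mul continuous_const)
  have hi2 : ∀ d (l : S.LiftIdx), Integrable (fun ξ : S.LiftIdx → ℝ => S.c (S.retr ξ) d * ξ l *
      if S.Observes d l.1 then y (Sum.inr (d, l)) else 0) S.P' := fun d l =>
    S.integrable_P' (((hc d).mul (continuous_apply l)).mul continuous_const)
  have hi3 := fun d => integrable_finsetSum Finset.univ fun l _ => hi2 d l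
  have hi4 : ∀ d, Integrable (fun ξ => S.c (S.retr ξ) d * y (Sum.inl d) +
      ∑ l : S.LiftIdx, (S.c (S.retr ξ) d * ξ l) *
        if S.Observes d l.1 then y (Sum.inr (d, l)) else 0) S.P' := fun d => (hi1 d).add (hi3 d)
  simp only [cost, h1]
  rw [integral_finsetSum _ fun d _ => hi4 d, dotProduct, Fintype.sum_sum_type,
    Fintype.sum_prod_type, ← Finset.sum_add_distrib]
  refine Finset.sum_congr rfl fun d _ => ?_
  rw [integral_add (hi1 d) (hi3 d), integral_finsetSum _ fun l _ => hi2 d l, integral_mul_const]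
  congr 1
  refine Finset.sum_congr rfl fun l _ => ?_
  rw [integral_mul_const]
  simp only [costVec, Sum.elim_inr]
  split_ifs <;> simp

/-! ### Duality for the lifted problem and the effect of the cuts -/

/-- The value of the affine decision rule problem over compact convex supports agrees with the
value of the conic program whenever there is a Slater point. -/
theorem affValue_eq_dualValue (hc : ∀ g, IsCompact (U g)) (hconv : ∀ g, Convex ℝ (U g))
    (hslater : ∃ x, S.IsSlaterPoint U x) :
    S.affValue U = S.dualValue {v | S.coefMap v = -S.costVec ∧ v ∈ S.dualCone U} := by
  apply le_antisymm
  · obtain ⟨x, hx⟩ := hslater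
    obtain ⟨ys, rfl⟩ := NonAnticipative.exists_policy S hx.1
    -- Only real `p` below the primal value need a dual point, so an unbounded primal requires
    -- nothing.
    refine EReal.ge_of_forall_gt_iff_ge.1 fun p hp => ?_
    obtain ⟨v, hv, hT, hpv⟩ := exists_conic_dual (isClosed_dualCone hc) (convex_dualCone hconv)
      (fun g k => Or.inl rfl) (fun t ht v hv => smul_mem_dualCone ht.le hv) S.coefMap S.homObj
      S.costVec ys (p := p) (fun v hv h0 => dotProduct_coefMap_lt hx hv h0) fun y hy => by
        have := hp.trans_le (iInf₂_le _ (policy_mem_affFeasible hy))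
        rw [cost_policy] at this
        exact (EReal.coe_lt_coe_iff.1 this).le
    rw [← dualObj_eq] at hpv
    exact (EReal.coe_le_coe_iff.2 hpv).trans
      (le_iSup₂ (f := fun (v : S.DualVar) (_ : v ∈ {v | S.coefMap v = -S.costVec ∧
        v ∈ S.dualCone U}) => (S.dualObj v : EReal)) v ⟨hT, hv⟩)
  · refine iSup₂_le fun v hv => le_iInf₂ fun x hx => ?_
    obtain ⟨y, rfl⟩ := NonAnticipative.exists_policy S hx.1
    have h := dotProduct_coefMap_le hx hv.2
    rw [hv.1, dotProduct_neg, dotProduct_comm] at h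
    rw [cost_policy, dualObj_eq, EReal.coe_le_coe_iff]
    linarith

theorem isConicProgram_of_dualCone (hc : ∀ g, IsCompact (U g)) (hconv : ∀ g, Convex ℝ (U g)) :
    IsConicProgram {v | S.coefMap v = -S.costVec ∧ v ∈ S.dualCone U} S.dualObj := by
  refine ⟨Convex.isConicRepresentable_of_isClosed ?_ ?_,
    (-S.homObj).toAffineMap, fun v => (S.dualObj_eq v).symm⟩
  · exact ((convex_singleton (-S.costVec)).linear_preimage S.coefMap).inter
      (convex_dualCone hconv)
  · exact (isClosed_singleton.preimage S.coefMap.continuous_of_finiteDimensional).inter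
      (isClosed_dualCone hc)

theorem dualFeasible_eq :
    S.dualFeasible = {v | S.coefMap v = -S.costVec ∧ v ∈ S.dualCone S.outer} := by
  ext v
  change _ ∧ _ ∧ _ ↔ _ ∧ _
  rw [← and_assoc, coefMap_eq_neg_costVec_iff]
  refine and_congr_right fun _ => forall_congr' fun g => forall_congr' fun k => ?_
  constructor
  · exact Or.inr
  · rintro (h | h)
    · obtain ⟨h1, h2⟩ := Prod.mk.inj h
      obtain ⟨ξ, hξ⟩ := S.nonempty_outer g
      exact ⟨h2.ge, ξ, hξ, by rw [h1, h2, zero_smul]⟩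
    · exact h

/-- For positive scale, dividing a cut by `s` gives the inequality defining `refined` at the base
point `ζ / s`. At scale zero `ζ` vanishes too and the cut is `0 ≤ 0`; as the apex always belongs to
`perspectiveCone`, nonemptiness of `refined` is not needed. -/
theorem dualFeasibleCuts_eq :
    S.dualFeasibleCuts = {v | S.coefMap v = -S.costVec ∧ v ∈ S.dualCone S.refined} := by
  ext v
  change v ∈ S.dualFeasible ∧ _ ↔ _
  rw [dualFeasible_eq]
  change (_ ∧ _) ∧ _ ↔ _ ∧ _
  rw [and_assoc]
  refine and_congr_right fun _ => ?_
  constructor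
  · rintro ⟨h1, h2⟩ g k
    rcases h1 g k with h | ⟨hs, ξ, hξ, he⟩
    · exact Or.inl h
    · dsimp only at hs he
      rcases hs.eq_or_lt with h0 | h0
      · exact Or.inl (by rw [he, ← h0, zero_smul]; rfl)
      · refine Or.inr ⟨hs, ξ, ⟨hξ, fun zl hl zu hu hlu => ?_⟩, he⟩
        have := h2 g k zl hl zu hu hlu
        rw [he, smul_smul, one_div_mul_cancel h0.ne', one_smul] at this
        exact le_of_mul_le_mul_left this h0
  · intro h
    refine ⟨fun g k => (h g k).imp_right fun ⟨hs, ξ, hξ, he⟩ => ⟨hs, ξ, hξ.1, he⟩,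
      fun g k zl hl zu hu hlu => ?_⟩
    rcases h g k with h | ⟨hs, ξ, hξ, he⟩
    · rw [(Prod.mk.inj h).2, zero_mul, zero_mul]
    · dsimp only at hs he
      rcases hs.eq_or_lt with h0 | h0
      · rw [← h0, zero_mul, zero_mul]
      · rw [he, smul_smul, one_div_mul_cancel h0.ne', one_smul]
        exact mul_le_mul_of_nonneg_left (hξ.2 zl hl zu hu hlu) hs

end MultistageProblem
end

theorem mainTheorem6 (S : MultistageProblem)
    (hconic : ∀ g, IsConicRepresentable (S.Ψ g)) :
    (IsConicProgram S.dualFeasible S.dualObj ∧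
      ((∃ x, S.IsSlaterPoint S.outer x) →
        S.affValue S.outer = S.dualValue S.dualFeasible)) ∧
    (IsConicProgram S.dualFeasibleCuts S.dualObj ∧
      ((∃ x, S.IsSlaterPoint S.refined x) →
        S.affValue S.refined = S.dualValue S.dualFeasibleCuts)) := by
  have ho := fun g => S.convex_outer (hconic g).convex
  have hr := fun g => S.convex_refined (hconic g).convex
  rw [S.dualFeasible_eq, S.dualFeasibleCuts_eq]
  exact ⟨⟨S.isConicProgram_of_dualCone S.isCompact_outer ho,
      S.affValue_eq_dualValue S.isCompact_outer ho⟩,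
    S.isConicProgram_of_dualCone S.isCompact_refined hr,
      S.affValue_eq_dualValue S.isCompact_refined hr⟩
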